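/- A pre-orthogeometry $\mathcal G=(P,L)$ is a set $P$ of points with a set $L$ of 3-element subsets of $P$, called lines, such that any two distinct points lie on at most one line. It is proper if every point lies on some line. A subspace is a set of points that contains every line of which it contains two points. A plane is a 7-point subspace which, together with the lines it contains, is isomorphic to the configuration formed by the three vertices, the three side midpoints and the center of a triangle, with its three sides and its three medians as lines. A Boolean subalgebra of an orthomodular poset $A$ is a subset that contains $0,1$, is closed under orthocomplements and joins of orthogonal elements, and is a Boolean algebra in the induced order. The orthogeometry of $A$ has as points the 4-element Boolean subalgebras of $A$ and as lines the 8-element ones, each identified with the set of points it contains. An orthogeometry is a pre-orthogeometry isomorphic to the orthogeometry of some orthomodular poset. A direction for a point $p$ assigns to each line through $p$ one of $\uparrow,\downarrow$, such that two lines $\ell,m$ through $p$ get opposite values iff they lie in a plane in which $\ell,m$ are the only lines through $p$. The directions of $\mathcal G$ are the directions for its points and two additional directions $0$ and $1$. The opposite $d'$ of a direction $d$ for a point is obtained by exchanging $\uparrow$ and $\downarrow$, and $0'=1$, $1'=0$. The partial sum $\oplus$ is given by $0\oplus d=d=d\oplus 0$, $d\oplus d'=1$ and: if $p,q,r$ are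 the three points of a line $\ell$, and $d,e,f$ are directions for $p,q,r$ with $d(\ell)=e(\ell)={\downarrow}$ and $f(\ell)={\uparrow}$, then $d\oplus e=f$. Put $d\le e$ iff $d\oplus f=e$ for some direction $f$. A cone of a set $D$ of directions is an upper bound of $D$, and a minimal cone of $D$ is a least upper bound of $D$, with respect to $\le$. **Theorem.** Let $\mathcal G$ be a proper orthogeometry. 1. $\mathcal G$ is isomorphic to the orthogeometry of an orthomodular lattice if and only if every set of exactly two directions of $\mathcal G$ has a minimal cone. 2. $\mathcal G$ is isomorphic to the orthogeometry of a complete orthomodular lattice if and only if every set of at least two directions of $\mathcal G$ has a minimal cone. -/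

import Mathlib

universe u v

/-! ### Orthomodular posets and (complete) orthomodular lattices -/

/-- An orthomodular poset: a bounded poset with an order-reversing involution `ᶜ` such that `aᶜ` is
a complement of `a`, orthogonal elements `a ≤ bᶜ` have a join, and the orthomodular law
`b = a ∨ (a ∨ bᶜ)ᶜ` holds for `a ≤ b`. -/
class OrthomodularPoset (A : Type u) extends PartialOrder A, BoundedOrder A, Compl A where
  protected compl_compl : ∀ a : A, aᶜᶜ = a
  protected compl_le_compl : ∀ a b : A, a ≤ b → bᶜ ≤ aᶜ
  protected isCompl_compl : ∀ a : A, IsCompl a aᶜ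
  protected exists_isLUB : ∀ a b : A, a ≤ bᶜ → ∃ c : A, IsLUB {a, b} c
  protected orthomodular : ∀ a b c : A, a ≤ b → IsLUB {a, bᶜ} c → IsLUB {a, cᶜ} b

/-- An orthomodular lattice: an orthomodular poset whose order is a lattice. -/
class OrthomodularLattice (A : Type u) extends Lattice A, OrthomodularPoset A

/-- A complete orthomodular lattice: an orthomodular poset whose order is a complete lattice. -/
class CompleteOrthomodularLattice (A : Type u) extends CompleteLattice A, OrthomodularPoset A

/-- A Boolean subalgebra of an orthomodular poset: a subset containing `0` and `1`, closed under
complements and under joins of orthogonal elements, which is a Boolean algebra in the induced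
order. -/
structure IsBooleanSubalgebra {A : Type u} [OrthomodularPoset A] (B : Set A) : Prop where
  bot_mem : ⊥ ∈ B
  top_mem : ⊤ ∈ B
  compl_mem : ∀ a ∈ B, aᶜ ∈ B
  isLUB_mem : ∀ a ∈ B, ∀ b ∈ B, a ≤ bᶜ → ∀ c : A, IsLUB {a, b} c → c ∈ B
  boolean : ∃ inst : BooleanAlgebra B, ∀ x y : B, inst.le x y ↔ (x : A) ≤ (y : A)

/-! ### Points and lines -/

/-- A set of points `P` together with a set of lines, each line being a set of points. -/
structure PointLineGeometry (P : Type u) where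
  lines : Set (Set P)

/-- An isomorphism: a bijection between the points that preserves and reflects lines. -/
structure PointLineGeometry.Iso {P : Type u} {Q : Type v}
    (G : PointLineGeometry P) (H : PointLineGeometry Q) where
  toEquiv : P ≃ Q
  mem_lines_iff : ∀ s : Set P, s ∈ G.lines ↔ toEquiv '' s ∈ H.lines

/-- The points attached to `A`: its 4-element Boolean subalgebras. -/
def BooleanPoint (A : Type u) [OrthomodularPoset A] : Type u :=
  {B : Set A // IsBooleanSubalgebra B ∧ B.ncard = 4}

/-- The points and lines of the hypergraph of `A`: the points are the 4-element Boolean subalgebras,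
the lines are the 8-element Boolean subalgebras, each viewed as the set of points that it
contains. -/
def booleanGeometry (A : Type u) [OrthomodularPoset A] : PointLineGeometry (BooleanPoint A) where
  lines := {s | ∃ C : Set A, IsBooleanSubalgebra C ∧ C.ncard = 8 ∧ s = {p | p.1 ⊆ C}}

/-- A pre-orthogeometry: every line has exactly 3 points, and two distinct points are contained in
at most one line. -/
structure PreOrthogeometry (P : Type u) extends PointLineGeometry P where
  ncard_line : ∀ l ∈ lines, l.ncard = 3
  line_unique : ∀ l ∈ lines, ∀ m ∈ lines, ∀ p q : P, p ≠ q →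
    p ∈ l → q ∈ l → p ∈ m → q ∈ m → l = m

namespace PreOrthogeometry

/-- `G` is the orthogeometry of `A`, up to isomorphism. -/
def IsOrthogeometryOf {P : Type u} (G : PreOrthogeometry P) (A : Type v)
    [OrthomodularPoset A] : Prop :=
  Nonempty (G.toPointLineGeometry.Iso (booleanGeometry A))

/-- An orthogeometry: a pre-orthogeometry isomorphic to that of some orthomodular poset. -/
def IsOrthogeometry {P : Type u} (G : PreOrthogeometry P) : Prop :=
  ∃ (A : Type u) (_ : OrthomodularPoset A), G.IsOrthogeometryOf A

/-- `G` is proper: every point lies on a line. -/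
def IsProper {P : Type u} (G : PreOrthogeometry P) : Prop :=
  ∀ p : P, ∃ l ∈ G.lines, p ∈ l

/-- A subspace: a set of points that contains every line of which it contains two points. -/
def IsSubspace {P : Type u} (G : PreOrthogeometry P) (S : Set P) : Prop :=
  ∀ l ∈ G.lines, ∀ p ∈ l, ∀ q ∈ l, p ≠ q → p ∈ S → q ∈ S → l ⊆ S

/-- The six lines of the standard plane on 7 points: a triangle with vertices `0, 1, 2`, its center
`3`, and the midpoints `4, 5, 6` of its sides; the lines are the three sides and the three
medians. -/
def planeLines : Set (Set (Fin 7)) :=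
  {{0, 1, 4}, {0, 2, 5}, {1, 2, 6}, {2, 3, 4}, {1, 3, 5}, {0, 3, 6}}

/-- A plane: a subspace of 7 points which, with the lines that it contains, is configured as the
standard plane. -/
def IsPlane {P : Type u} (G : PreOrthogeometry P) (S : Set P) : Prop :=
  G.IsSubspace S ∧ ∃ f : Fin 7 → P, Function.Injective f ∧ Set.range f = S ∧
    ∀ t : Set (Fin 7), f '' t ∈ G.lines ↔ t ∈ planeLines

/-! ### Directions -/

/-- The two possible values `↑` and `↓` of a direction on a line. -/
inductive Arrow
  | up
  | down

/-- The opposite arrow. -/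
def Arrow.flip : Arrow → Arrow
  | Arrow.up => Arrow.down
  | Arrow.down => Arrow.up

theorem Arrow.flip_ne_flip_iff (x y : Arrow) : x.flip ≠ y.flip ↔ x ≠ y := by
  cases x <;> cases y <;> simp [Arrow.flip]

/-- The lines through the point `p`. -/
def LineThrough {P : Type u} (G : PreOrthogeometry P) (p : P) : Type u :=
  {l : Set P // l ∈ G.lines ∧ p ∈ l}

/-- A direction for the point `p`: an assignment of `↑` or `↓` to each line through `p` such that
two lines `l, m` through `p` have opposite values iff they are contained in a plane in which
`l` and `m` are the only lines through `p`. -/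
structure DirectionAt {P : Type u} (G : PreOrthogeometry P) (p : P) where
  val : G.LineThrough p → Arrow
  val_ne_iff : ∀ l m : G.LineThrough p, val l ≠ val m ↔
    ∃ S : Set P, G.IsPlane S ∧ {n | n ∈ G.lines ∧ p ∈ n ∧ n ⊆ S} = {l.1, m.1}

/-- The directions of `G`: the directions for the points of `G`, and two additional directions
`0` and `1`. -/
inductive Direction {P : Type u} (G : PreOrthogeometry P) : Type u
  | zero : Direction G
  | one : Direction G
  | ofPoint (p : P) (d : G.DirectionAt p) : Direction G

variable {P : Type u} {G : PreOrthogeometry P}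

/-- The opposite direction for the same point. -/
def DirectionAt.compl {p : P} (d : G.DirectionAt p) : G.DirectionAt p where
  val l := (d.val l).flip
  val_ne_iff l m := (Arrow.flip_ne_flip_iff _ _).trans (d.val_ne_iff l m)

/-- The orthocomplementation on directions. -/
def Direction.compl : G.Direction → G.Direction
  | .zero => .one
  | .one => .zero
  | .ofPoint p d => .ofPoint p d.compl

/-- `OSum d e f` means that the orthogonal sum `d ⊕ e` of the directions `d` and `e` is defined and
equal to `f`: `0 ⊕ d = d ⊕ 0 = d`, `d ⊕ d' = 1`, and if `p, q, r` are the three points of a line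
`l` and `d, e` are directions for `p, q` with value `↓` at `l`, then `d ⊕ e` is the direction for
`r` with value `↑` at `l`. -/
inductive Direction.OSum : G.Direction → G.Direction → G.Direction → Prop
  | zero_left (d : G.Direction) : OSum .zero d d
  | zero_right (d : G.Direction) : OSum d .zero d
  | compl_right (d : G.Direction) : OSum d d.compl .one
  | line (l : Set P) (hl : l ∈ G.lines) (p q r : P) (hp : p ∈ l) (hq : q ∈ l) (hr : r ∈ l)
      (hpq : p ≠ q) (hpr : p ≠ r) (hqr : q ≠ r)
      (d : G.DirectionAt p) (e : G.DirectionAt q) (f : G.DirectionAt r)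
      (hd : d.val ⟨l, hl, hp⟩ = Arrow.down) (he : e.val ⟨l, hl, hq⟩ = Arrow.down)
      (hf : f.val ⟨l, hl, hr⟩ = Arrow.up) :
      OSum (.ofPoint p d) (.ofPoint q e) (.ofPoint r f)

/-- The natural ordering of directions: `d ≤ e` iff `d ⊕ f = e` for some `f`. -/
def Direction.Le (d e : G.Direction) : Prop :=
  ∃ f : G.Direction, Direction.OSum d f e

/-- `e` is a cone of `D`: an upper bound of `D` in the natural ordering. -/
def IsCone (D : Set G.Direction) (e : G.Direction) : Prop :=
  ∀ d ∈ D, Direction.Le d e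

/-- `e` is a minimal cone of `D`: a least upper bound of `D` in the natural ordering. -/
def IsMinimalCone (D : Set G.Direction) (e : G.Direction) : Prop :=
  IsCone D e ∧ ∀ f : G.Direction, IsCone D f → Direction.Le e f

end PreOrthogeometry

/-! A point of the orthogeometry of A is a complementary pair {a, aᶜ} of nontrivial elements, and a
line is a triple of nonzero pairwise orthogonal elements with join 1. The geometry forgets which of
a, aᶜ is meant; directions recover it. On a line through its point, a is `down` if it is an atom of
the 8-element algebra of that line and `up` if it is a coatom.

Planes make this a direction. If a is an atom for one line and a coatom for another, then aᶜ and a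
both split in two, and the four pieces are the atoms of a 16-element Boolean algebra whose geometry
is the standard plane with a at a midpoint (`exists_isPlane`). If a is an atom for both lines, such
a plane would make too many elements comparable (`not_isAtomOf_of_isPlane`).

One arrow determines a direction, so by properness each point has exactly two, those of a and aᶜ.
For nontrivial A, directions thus correspond to elements, and the orders agree
(`Represents.le_iff`), so minimal cones are joins. Meets come from complements, and sets with at
most one element have joins anyway. The one-element poset, whose geometry still has two directions,
is treated apart. -/

namespace OrthomodularPoset

/-! ### Orthogonal triples and comparability -/

variable {A : Type u} [OrthomodularPoset A] {a b c x y z : A}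

theorem le_compl_symm (h : a ≤ bᶜ) : b ≤ aᶜ := by
  simpa [OrthomodularPoset.compl_compl] using OrthomodularPoset.compl_le_compl _ _ h

theorem compl_le_symm (h : aᶜ ≤ b) : bᶜ ≤ a := by
  simpa [OrthomodularPoset.compl_compl] using OrthomodularPoset.compl_le_compl _ _ h

theorem le_of_compl_le_compl (h : aᶜ ≤ bᶜ) : b ≤ a := by
  simpa [OrthomodularPoset.compl_compl] using OrthomodularPoset.compl_le_compl _ _ h

theorem eq_bot_of_le_of_le_compl (h : a ≤ b) (h' : a ≤ bᶜ) : a = ⊥ :=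
  le_bot_iff.1 ((OrthomodularPoset.isCompl_compl b).disjoint h h')

theorem compl_bot : (⊥ : A)ᶜ = ⊤ :=
  top_le_iff.1 ((OrthomodularPoset.isCompl_compl (⊥ : A)).codisjoint bot_le le_rfl)

theorem compl_top : (⊤ : A)ᶜ = ⊥ := by
  rw [← compl_bot, OrthomodularPoset.compl_compl]

theorem compl_ne_bot (h : a ≠ ⊤) : aᶜ ≠ ⊥ := fun h' => h <| by
  rw [← OrthomodularPoset.compl_compl a, h', compl_bot]

theorem compl_ne_top (h : a ≠ ⊥) : aᶜ ≠ ⊤ := fun h' => h <| by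
  rw [← OrthomodularPoset.compl_compl a, h', compl_top]

/-- Three nonzero, pairwise orthogonal elements with join `1`. -/
structure OrthoTriple (x y z : A) : Prop where
  left_ne_bot : x ≠ ⊥
  mid_ne_bot : y ≠ ⊥
  right_ne_bot : z ≠ ⊥
  le_compl : x ≤ yᶜ
  isLUB : IsLUB {x, y} zᶜ

namespace OrthoTriple

theorem swap (h : OrthoTriple x y z) : OrthoTriple y x z :=
  ⟨h.2, h.1, h.3, le_compl_symm h.4, by rw [Set.pair_comm]; exact h.5⟩

theorem left_le (h : OrthoTriple x y z) : x ≤ zᶜ := h.isLUB.1 (by simp)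

theorem mid_le (h : OrthoTriple x y z) : y ≤ zᶜ := h.isLUB.1 (by simp)

/-- The orthomodular law for x ≤ yᶜ. With `swap` it makes the asymmetric definition of a triple
invariant under all permutations. -/
theorem swap_right (h : OrthoTriple x y z) : OrthoTriple x z y :=
  ⟨h.1, h.3, h.2, h.left_le, by
    simpa only [OrthomodularPoset.compl_compl] using OrthomodularPoset.orthomodular _ _ zᶜ h.le_compl
      (by simpa only [OrthomodularPoset.compl_compl] using h.isLUB)⟩

theorem rotate (h : OrthoTriple x y z) : OrthoTriple y z x := h.swap.swap_right

theorem compl_le (h : OrthoTriple x y z) (hx : x ≤ a) (hy : y ≤ a) : zᶜ ≤ a :=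
  h.isLUB.2 (by simp [hx, hy])

theorem left_ne_top (h : OrthoTriple x y z) : x ≠ ⊤ := by
  rintro rfl
  exact h.mid_ne_bot (le_bot_iff.1 (by simpa [compl_top] using h.swap.le_compl))

theorem left_ne_mid (h : OrthoTriple x y z) : x ≠ y := by
  rintro rfl
  exact h.left_ne_bot (eq_bot_of_le_of_le_compl le_rfl h.le_compl)

theorem left_ne_compl_mid (h : OrthoTriple x y z) : x ≠ yᶜ := by
  rintro rfl
  exact h.right_ne_bot
    (eq_bot_of_le_of_le_compl (le_compl_symm h.mid_le) (le_compl_symm h.left_le))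

end OrthoTriple

/-- The third member is (a ∨ b)ᶜ. Were it zero, the orthomodular law would give bᶜ = a ∨ 0 = a. -/
theorem exists_orthoTriple (ha : a ≠ ⊥) (hb : b ≠ ⊥) (h : a ≤ bᶜ) (hne : a ≠ bᶜ) :
    ∃ c, OrthoTriple a b c := by
  obtain ⟨c, hc⟩ := OrthomodularPoset.exists_isLUB a b h
  refine ⟨cᶜ, ha, hb, compl_ne_bot ?_, h, by rwa [OrthomodularPoset.compl_compl]⟩
  rintro rfl
  have := OrthomodularPoset.orthomodular a bᶜ ⊤ h (by rwa [OrthomodularPoset.compl_compl])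
  refine hne (le_antisymm h (this.2 ?_))
  simp [compl_top]

/-- Two elements generate a Boolean subalgebra with at most eight elements. -/
def Comparable (a b : A) : Prop := a ≤ b ∨ a ≤ bᶜ ∨ aᶜ ≤ b ∨ aᶜ ≤ bᶜ

namespace Comparable

theorem symm (h : Comparable a b) : Comparable b a := by
  rcases h with h | h | h | h
  · exact .inr <| .inr <| .inr (OrthomodularPoset.compl_le_compl _ _ h)
  · exact .inr <| .inl (le_compl_symm h)
  · exact .inr <| .inr <| .inl (compl_le_symm h)
  · exact .inl (le_of_compl_le_compl h)

theorem compl_left (h : Comparable a b) : Comparable aᶜ b := by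
  unfold Comparable at *
  rw [OrthomodularPoset.compl_compl]
  tauto

end Comparable

/-- Suppose b ≤ e. Then c ≤ e gives aᶜ = b ∨ c ≤ e and so g = 0; c ≤ eᶜ gives bᶜ = a ∨ c ≤ eᶜ and so
b = e; cᶜ ≤ e gives a ≤ e ≤ aᶜ; and e ≤ c gives b ≤ c although b and c are orthogonal. -/
theorem OrthoTriple.le_compl_of_comparable {b e g : A} (h : OrthoTriple a b c)
    (h' : OrthoTriple a e g) (hce : Comparable c e) (hne : b ≠ e) :
    ¬ b ≤ e := by
  intro hb
  have hea : e ≤ aᶜ := h'.swap.le_compl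
  rcases hce with hc | hc | hc | hc
  · have : aᶜ ≤ e := h.rotate.compl_le hb hc
    exact h'.right_ne_bot (eq_bot_of_le_of_le_compl
      (h'.rotate.swap.le_compl.trans (compl_le_symm this)) h'.swap_right.swap.le_compl)
  · have : bᶜ ≤ eᶜ := h.swap_right.compl_le h'.le_compl hc
    exact hne (le_antisymm hb (le_of_compl_le_compl this))
  · exact h.left_ne_bot (eq_bot_of_le_of_le_compl le_rfl (h.left_le.trans (hc.trans hea)))
  · exact h.mid_ne_bot (eq_bot_of_le_of_le_compl (hb.trans (le_of_compl_le_compl hc)) h.mid_le)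

/-- Comparability forces b to be orthogonal to both e and g, hence to e ∨ g = aᶜ. So b ≤ a, while b
≤ aᶜ and b is nonzero. -/
theorem OrthoTriple.not_pairwise_comparable {b e g : A} (h : OrthoTriple a b c)
    (h' : OrthoTriple a e g) (hbe : Comparable b e) (hce : Comparable c e) (hbg : Comparable b g)
    (hcg : Comparable c g) (hbe_ne : b ≠ e) (hbg_ne : b ≠ g) : False := by
  have key : ∀ {b c e g : A}, OrthoTriple a b c → OrthoTriple a e g → Comparable b e →
      Comparable c e → Comparable b g → b ≠ e → b ≤ eᶜ := by
    intro b c e g h h' hbe hce hbg hne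
    rcases id hbe with hb | hb | hb | hb
    · exact (h.le_compl_of_comparable h' hce hne hb).elim
    · exact hb
    · exact (h.left_ne_bot (eq_bot_of_le_of_le_compl le_rfl
        (h.le_compl.trans (hb.trans h'.swap.le_compl)))).elim
    · exact (h'.le_compl_of_comparable h hbg.symm hne.symm (le_of_compl_le_compl hb)).elim
  have h₁ := key h h' hbe hce hbg hbe_ne
  have h₂ := key h h'.swap_right hbg hcg hbe hbg_ne
  have h₃ : aᶜ ≤ bᶜ := h'.rotate.compl_le (le_compl_symm h₁) (le_compl_symm h₂)
  exact h.mid_ne_bot (eq_bot_of_le_of_le_compl (le_of_compl_le_compl h₃) h.swap.le_compl)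

/-- Nonzero `x, y ≤ a`, `b, c ≤ aᶜ` with `x, b ≤ sᶜ` and `y, c ≤ s` obstruct comparability. -/
theorem not_comparable {b s : A} (hx : x ≠ ⊥) (hy : y ≠ ⊥) (hb : b ≠ ⊥) (hc : c ≠ ⊥) (hxa : x ≤ a)
    (hya : y ≤ a) (hba : b ≤ aᶜ) (hca : c ≤ aᶜ) (hxs : x ≤ sᶜ) (hbs : b ≤ sᶜ) (hys : y ≤ s)
    (hcs : c ≤ s) : ¬ Comparable a s := by
  rintro (h | h | h | h)
  · exact hx (eq_bot_of_le_of_le_compl (hxa.trans h) hxs)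
  · exact hy (eq_bot_of_le_of_le_compl hys (hya.trans h))
  · exact hb (eq_bot_of_le_of_le_compl (hba.trans h) hbs)
  · exact hc (eq_bot_of_le_of_le_compl hcs (hca.trans h))

/-- Refining an element `a` and its complement gives a partition of unity into four. -/
theorem OrthoTriple.exists_cross {b : A} (h : OrthoTriple aᶜ x y) (h' : OrthoTriple a b c) :
    ∃ s, OrthoTriple x b s ∧ OrthoTriple y c sᶜ := by
  have hx : x ≤ a := by simpa only [OrthomodularPoset.compl_compl] using h.swap.le_compl
  have hy : y ≤ a := by
    simpa only [OrthomodularPoset.compl_compl] using h.swap_right.swap.le_compl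
  have hb : b ≤ aᶜ := h'.swap.le_compl
  have hc : c ≤ aᶜ := h'.swap_right.swap.le_compl
  have orth : ∀ {u v : A}, u ≤ a → v ≤ aᶜ → u ≤ vᶜ := fun hu hv =>
    hu.trans (le_compl_symm hv)
  have hyx : y ≤ xᶜ := h.rotate.swap.le_compl
  have hcb : c ≤ bᶜ := h'.rotate.swap.le_compl
  obtain ⟨s, hs⟩ := exists_orthoTriple h.mid_ne_bot h'.mid_ne_bot (orth hx hb) (by
    rintro rfl
    exact h'.right_ne_bot (eq_bot_of_le_of_le_compl hcb
      (hc.trans (OrthomodularPoset.compl_le_compl _ _ hx))))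
  have hys : y ≤ s := 
    le_of_compl_le_compl (hs.compl_le (le_compl_symm hyx) (le_compl_symm (orth hy hb)))
  have hcs : c ≤ s := le_of_compl_le_compl (hs.compl_le (orth hx hc) (le_compl_symm hcb))
  refine ⟨s, hs, h.right_ne_bot, h'.right_ne_bot, compl_ne_bot ?_, orth hy hc, ?_⟩
  · exact hs.rotate.rotate.left_ne_top
  rw [OrthomodularPoset.compl_compl]
  refine ⟨by simp [hys, hcs], fun u hu => ?_⟩
  simp only [mem_upperBounds, Set.mem_insert_iff, Set.mem_singleton_iff, forall_eq_or_imp,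
    forall_eq] at hu
  -- It remains to see that t = y ∨ c is s. As t ≤ s, orthomodularity reduces this to t ∨ sᶜ = 1,
  -- which holds because an upper bound dominates x, y, b, c and hence both a and aᶜ.
  obtain ⟨t, ht⟩ := OrthomodularPoset.exists_isLUB y c (orth hy hc)
  have hts : t ≤ s := ht.2 (by simp [hys, hcs])
  have hst : IsLUB {t, sᶜ} (⊤ : A) := by
    refine ⟨by simp, fun v hv => ?_⟩
    simp only [mem_upperBounds, Set.mem_insert_iff, Set.mem_singleton_iff, forall_eq_or_imp,
      forall_eq] at hv
    have hyv : y ≤ v := (ht.1 (by simp)).trans hv.1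
    have hcv : c ≤ v := (ht.1 (by simp)).trans hv.1
    have ha : aᶜᶜ ≤ v := h.rotate.compl_le (hs.left_le.trans hv.2) hyv
    have ha' : aᶜ ≤ v := h'.rotate.compl_le (hs.mid_le.trans hv.2) hcv
    exact (OrthomodularPoset.isCompl_compl aᶜ).codisjoint ha' ha
  have := OrthomodularPoset.orthomodular t s ⊤ hts hst
  have hs' : s ≤ t := this.2 (by simp [compl_top])
  exact hs'.trans (ht.2 (by simp [hu]))

end OrthomodularPoset

/-! ### Boolean subalgebras generated by one element or by a triple -/

namespace OrthomodularPoset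

variable {A : Type u} [OrthomodularPoset A] {a b c x y z : A}

section generated

variable {n : ℕ} {atom : Fin n → A} {g : Set (Fin n) → A}

/-- By `hg`, `g s` is the join of the atoms indexed by s. An index in s but not in t would give an
atom below both `g t` and its complement. -/
theorem le_iff_subset_of_partition (h : ∀ i, atom i ≠ ⊥)
    (hg : ∀ s u, g s ≤ u ↔ ∀ i ∈ s, atom i ≤ u) (hc : ∀ s, g sᶜ = (g s)ᶜ) (s t : Set (Fin n)) :
    g s ≤ g t ↔ s ⊆ t := by
  have hle : ∀ s, ∀ i ∈ s, atom i ≤ g s := fun s => (hg s _).1 le_rfl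
  rw [hg]
  refine ⟨fun H i hi => ?_, fun H i hi => hle _ _ (H hi)⟩
  by_contra hit
  exact h i (eq_bot_of_le_of_le_compl (H i hi) ((hle _ i hit).trans_eq (hc t)))

/-- `g` is an order embedding of the power set that respects complements, so the Boolean structure
is transported to its range. -/
theorem isBooleanSubalgebra_of_partition (h : ∀ i, atom i ≠ ⊥)
    (hg : ∀ s u, g s ≤ u ↔ ∀ i ∈ s, atom i ≤ u) (hc : ∀ s, g sᶜ = (g s)ᶜ) :
    IsBooleanSubalgebra (Set.range g) ∧ (Set.range g).ncard = 2 ^ n := by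
  have hsub := le_iff_subset_of_partition h hg hc
  have hinj : Function.Injective g := fun s t hst =>
    Set.Subset.antisymm ((hsub _ _).1 hst.le) ((hsub _ _).1 hst.ge)
  have hbot : g ∅ = ⊥ := le_bot_iff.1 ((hg _ _).2 (by simp))
  refine ⟨⟨⟨∅, hbot⟩, ⟨Set.univ, ?_⟩, ?_, ?_, ?_⟩, ?_⟩
  · rw [← Set.compl_empty, hc, hbot, compl_bot]
  · rintro _ ⟨s, rfl⟩
    exact ⟨sᶜ, hc s⟩
  · rintro _ ⟨s, rfl⟩ _ ⟨t, rfl⟩ - c hcl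
    refine ⟨s ∪ t, IsLUB.unique ⟨?_, fun u hu => ?_⟩ hcl⟩
    · simp [hsub]
    · simp only [mem_upperBounds, Set.mem_insert_iff, Set.mem_singleton_iff, forall_eq_or_imp,
        forall_eq, hg] at hu
      exact (hg _ _).2 fun i hi => hi.elim (hu.1 i) (hu.2 i)
  · let e : Set.range g ≃ Set (Fin n) := (Equiv.ofInjective g hinj).symm
    have he : ∀ x y : Set.range g, e x ≤ e y ↔ (x : A) ≤ y := by
      intro x y
      obtain ⟨s, rfl⟩ := (Equiv.ofInjective g hinj).surjective x
      obtain ⟨t, rfl⟩ := (Equiv.ofInjective g hinj).surjective y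
      simp [e, hsub]
    exact ⟨{ (inferInstance : PartialOrder (Set.range g)) with
      sup := fun x y => e.symm (e x ⊔ e y)
      inf := fun x y => e.symm (e x ⊓ e y)
      top := e.symm ⊤
      bot := e.symm ⊥
      compl := fun x => e.symm (e x)ᶜ
      le_sup_left := fun x y => (he _ _).1 (by simp)
      le_sup_right := fun x y => (he _ _).1 (by simp)
      sup_le := fun x y z hx hy => (he _ _).1 (by simpa using ⟨(he _ _).2 hx, (he _ _).2 hy⟩)
      inf_le_left := fun x y => (he _ _).1 (by simp)
      inf_le_right := fun x y => (he _ _).1 (by simp)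
      le_inf := fun x y z hx hy => (he _ _).1 (by simpa using ⟨(he _ _).2 hx, (he _ _).2 hy⟩)
      le_sup_inf := fun x y z => (he _ _).1 (by
        change e (e.symm (e (e.symm _) ⊓ e (e.symm _))) ≤ e (e.symm (_ ⊔ e (e.symm _)))
        simp only [Equiv.apply_symm_apply]
        exact le_sup_inf)
      le_top := fun x => (he _ _).1 (by simp)
      bot_le := fun x => (he _ _).1 (by simp)
      inf_compl_le_bot := fun x => (he _ _).1 (by
        change e (e.symm (e x ⊓ e (e.symm _))) ≤ _
        simp)
      top_le_sup_compl := fun x => (he _ _).1 (by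
        change _ ≤ e (e.symm (e x ⊔ e (e.symm _)))
        simp) }, fun x y => Iff.rfl⟩
  · rw [← Set.image_univ, Set.ncard_image_of_injective _ hinj, Set.ncard_univ]
    simp [Nat.card_eq_fintype_card]

end generated

/-- The Boolean subalgebra generated by one element. -/
def pairSpan (a : A) : Set A := {⊥, ⊤, a, aᶜ}

theorem mem_pairSpan : b ∈ pairSpan a ↔ b = ⊥ ∨ b = ⊤ ∨ b = a ∨ b = aᶜ := Iff.rfl

/-- The Boolean subalgebra generated by an orthogonal triple. -/
def tripleSpan (x y z : A) : Set A := {⊥, ⊤, x, y, z, xᶜ, yᶜ, zᶜ}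

theorem isBooleanSubalgebra_pairSpan (ha : a ≠ ⊥) (ha' : a ≠ ⊤) :
    IsBooleanSubalgebra (pairSpan a) ∧ (pairSpan a).ncard = 4 := by
  classical
  let g : Set (Fin 2) → A := fun s =>
    if 0 ∈ s then if 1 ∈ s then ⊤ else a else if 1 ∈ s then aᶜ else ⊥
  have hr : Set.range g = pairSpan a := by
    ext b
    rw [mem_pairSpan]
    constructor
    · rintro ⟨s, rfl⟩
      simp only [g]
      split_ifs <;> simp
    · rintro (rfl | rfl | rfl | rfl)
      exacts [⟨∅, by simp [g]⟩, ⟨Set.univ, by simp [g]⟩, ⟨{0}, by simp [g]⟩, ⟨{1}, by simp [g]⟩]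
  rw [← hr]
  refine isBooleanSubalgebra_of_partition (atom := ![a, aᶜ]) ?_ ?_ ?_
  · simp [Fin.forall_fin_two, ha, compl_ne_bot ha']
  · intro s u
    simp only [g, Fin.forall_fin_two]
    by_cases h0 : 0 ∈ s <;> by_cases h1 : 1 ∈ s <;> simp [h0, h1]
    exact ⟨fun h => by simp [h], fun h =>
      top_le_iff.1 ((OrthomodularPoset.isCompl_compl a).codisjoint h.1 h.2)⟩
  · intro s
    simp only [g, Set.mem_compl_iff]
    by_cases h0 : 0 ∈ s <;> by_cases h1 : 1 ∈ s <;>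
      simp [h0, h1, compl_bot, compl_top, OrthomodularPoset.compl_compl]

theorem OrthoTriple.isBooleanSubalgebra_tripleSpan (h : OrthoTriple x y z) :
    IsBooleanSubalgebra (tripleSpan x y z) ∧ (tripleSpan x y z).ncard = 8 := by
  classical
  -- The join of two members of the triple is the complement of the third.
  let g : Set (Fin 3) → A := fun s =>
    if 0 ∈ s then if 1 ∈ s then if 2 ∈ s then ⊤ else zᶜ else if 2 ∈ s then yᶜ else x
    else if 1 ∈ s then if 2 ∈ s then xᶜ else y else if 2 ∈ s then z else ⊥
  have hr : Set.range g = tripleSpan x y z := by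
    ext b
    simp only [tripleSpan, Set.mem_insert_iff, Set.mem_singleton_iff]
    constructor
    · rintro ⟨s, rfl⟩
      simp only [g]
      split_ifs <;> simp
    · rintro (rfl | rfl | rfl | rfl | rfl | rfl | rfl | rfl)
      exacts [⟨∅, by simp [g]⟩, ⟨Set.univ, by simp [g]⟩, ⟨{0}, by simp [g]⟩, ⟨{1}, by simp [g]⟩,
        ⟨{2}, by simp [g]⟩, ⟨{1, 2}, by simp [g]⟩, ⟨{0, 2}, by simp [g]⟩, ⟨{0, 1}, by simp [g]⟩]
  have pair : ∀ {x y z u : A}, OrthoTriple x y z → (zᶜ ≤ u ↔ x ≤ u ∧ y ≤ u) := fun h =>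
    ⟨fun hu => ⟨h.left_le.trans hu, h.mid_le.trans hu⟩, fun hu => h.compl_le hu.1 hu.2⟩
  rw [← hr]
  refine isBooleanSubalgebra_of_partition (atom := ![x, y, z]) ?_ ?_ ?_
  · simp [Fin.forall_fin_succ, h.left_ne_bot, h.mid_ne_bot, h.right_ne_bot]
  · intro s u
    simp only [g, Fin.forall_fin_succ, IsEmpty.forall_iff]
    by_cases h0 : 0 ∈ s <;> by_cases h1 : 1 ∈ s <;> by_cases h2 : 2 ∈ s <;>
      simp [h0, h1, h2, pair h, pair h.rotate, pair h.swap_right]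
    exact ⟨fun h => by simp [h], fun H => top_le_iff.1
      ((OrthomodularPoset.isCompl_compl z).codisjoint H.2.2 (h.compl_le H.1 H.2.1))⟩
  · intro s
    simp only [g, Set.mem_compl_iff]
    by_cases h0 : 0 ∈ s <;> by_cases h1 : 1 ∈ s <;> by_cases h2 : 2 ∈ s <;>
      simp [h0, h1, h2, compl_bot, compl_top, OrthomodularPoset.compl_compl]

end OrthomodularPoset

/-! ### Structure of the 4- and 8-element Boolean subalgebras -/

open OrthomodularPoset

/-- A finite Boolean algebra is the power set of its atoms, and its cardinality determines their
number. -/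
theorem BooleanAlgebra.exists_orderIso {α : Type u} [BooleanAlgebra α] [Finite α] {n : ℕ}
    (h : Nat.card α = 2 ^ n) : Nonempty (α ≃o Set (Fin n)) := by
  classical
  have := Fintype.ofFinite α
  let inst : CompleteAtomicBooleanAlgebra α := Fintype.toCompleteAtomicBooleanAlgebra α
  let e : α ≃o Set {a : α // IsAtom a} := CompleteAtomicBooleanAlgebra.toSetOfIsAtom
  have hcard : Nat.card {a : α // IsAtom a} = n := by
    have h₁ := Nat.card_congr e.toEquiv
    have h₂ : Nat.card (Set {a : α // IsAtom a}) = 2 ^ Nat.card {a : α // IsAtom a} := by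
      simp [Nat.card_eq_fintype_card]
    rw [h, h₂] at h₁
    exact (Nat.pow_right_injective (le_refl 2) h₁).symm
  let f : {a : α // IsAtom a} ≃ Fin n := Finite.equivFinOfCardEq hcard
  exact ⟨e.trans ⟨Equiv.Set.congr f, by simp [Equiv.Set.congr]⟩⟩

namespace IsBooleanSubalgebra

variable {A : Type u} [OrthomodularPoset A] {a b c x y z : A} {B C : Set A}

theorem pairSpan_subset (hB : IsBooleanSubalgebra B) (ha : a ∈ B) : pairSpan a ⊆ B := by
  rintro b (rfl | rfl | rfl | rfl)
  exacts [hB.bot_mem, hB.top_mem, ha, hB.compl_mem _ ha]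

theorem tripleSpan_subset (hB : IsBooleanSubalgebra B) (hx : x ∈ B) (hy : y ∈ B) (hz : z ∈ B) :
    tripleSpan x y z ⊆ B := by
  rintro b (rfl | rfl | rfl | rfl | rfl | rfl | rfl | rfl)
  exacts [hB.bot_mem, hB.top_mem, hx, hy, hz, hB.compl_mem _ hx, hB.compl_mem _ hy,
    hB.compl_mem _ hz]

theorem eq_pairSpan (hB : IsBooleanSubalgebra B) (h : B.ncard = 4) (ha : a ∈ B) (ha₀ : a ≠ ⊥)
    (ha₁ : a ≠ ⊤) : B = pairSpan a :=
  (Set.eq_of_subset_of_ncard_le (hB.pairSpan_subset ha)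
    (by rw [h, (isBooleanSubalgebra_pairSpan ha₀ ha₁).2])
    (Set.finite_of_ncard_ne_zero (by simp [h]))).symm

theorem exists_mem_ne (h : B.ncard = 4) : ∃ a ∈ B, a ≠ ⊥ ∧ a ≠ ⊤ := by
  have : ¬ B ⊆ {⊥, ⊤} := fun H => by
    have h₁ := Set.ncard_le_ncard H
    have h₂ := Set.ncard_insert_le (⊥ : A) {⊤}
    rw [Set.ncard_singleton] at h₂
    omega
  obtain ⟨a, ha, h'⟩ := Set.not_subset.1 this
  simp only [Set.mem_insert_iff, Set.mem_singleton_iff, not_or] at h'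
  exact ⟨a, ha, h'.1, h'.2⟩

theorem exists_orderIso (hC : IsBooleanSubalgebra C) {n : ℕ} (h : C.ncard = 2 ^ n) :
    Nonempty (C ≃o Set (Fin n)) := by
  have hfin : C.Finite := Set.finite_of_ncard_ne_zero (by simp [h])
  have : Finite C := hfin
  obtain ⟨inst, hinst⟩ := hC.boolean
  obtain ⟨e⟩ := BooleanAlgebra.exists_orderIso (α := C) (n := n)
    ((Nat.card_coe_set_eq C).trans h)
  exact ⟨⟨e.toEquiv, fun {x y} => e.map_rel_iff.trans (hinst x y)⟩⟩

/-- The atoms form the triple. The isomorphism with the power set concerns only the induced order,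
so complements and joins must be matched with those of A: a complement in A is also one inside C,
where complements are unique, and the orthogonal join lies in C by closure. -/
theorem exists_eq_tripleSpan (hC : IsBooleanSubalgebra C) (h : C.ncard = 8) :
    ∃ x y z, OrthoTriple x y z ∧ C = tripleSpan x y z := by
  obtain ⟨e⟩ := hC.exists_orderIso (n := 3) h
  let f : Set (Fin 3) → A := fun s => e.symm s
  have hf : ∀ s t, f s ≤ f t ↔ s ⊆ t := fun s t => e.symm.le_iff_le
  have hmem : ∀ s, f s ∈ C := fun s => (e.symm s).2
  have hsurj : ∀ a ∈ C, ∃ s, f s = a := fun a ha => ⟨e ⟨a, ha⟩, by simp [f]⟩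
  have hbot : f ∅ = ⊥ := by
    obtain ⟨s, hs⟩ := hsurj ⊥ hC.bot_mem
    exact le_bot_iff.1 (hs ▸ (hf _ _).2 (Set.empty_subset s))
  have hne : ∀ i, f {i} ≠ ⊥ := fun i hi => by
    have := (hf {i} ∅).1 (by rw [hi, hbot])
    simp at this
  have hcompl : ∀ s, (f s)ᶜ = f sᶜ := by
    intro s
    obtain ⟨t, ht⟩ := hsurj _ (hC.compl_mem _ (hmem s))
    have hd := (OrthomodularPoset.isCompl_compl (f s)).disjoint
    have hc := (OrthomodularPoset.isCompl_compl (f s)).codisjoint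
    rw [← ht] at hd hc ⊢
    have h₁ : s ∩ t = ∅ := by
      have := hd ((hf (s ∩ t) s).2 Set.inter_subset_left) ((hf _ _).2 Set.inter_subset_right)
      rw [← hbot, hf] at this
      exact Set.subset_empty_iff.1 this
    have h₂ : s ∪ t = Set.univ := by
      have := hc ((hf s (s ∪ t)).2 Set.subset_union_left) ((hf _ _).2 Set.subset_union_right)
      have := (le_top : f Set.univ ≤ ⊤).trans this
      rw [hf] at this
      exact Set.univ_subset_iff.1 this
    congr 1
    have : IsCompl s t := ⟨Set.disjoint_iff_inter_eq_empty.2 h₁, codisjoint_iff.2 h₂⟩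
    exact this.compl_eq.symm
  have hle : f {0} ≤ (f {1})ᶜ := by rw [hcompl, hf]; simp
  have ht : OrthoTriple (f {0}) (f {1}) (f {2}) := by
    refine ⟨hne 0, hne 1, hne 2, hle, ?_⟩
    obtain ⟨c, hc⟩ := OrthomodularPoset.exists_isLUB _ _ hle
    obtain ⟨t, rfl⟩ := hsurj c (hC.isLUB_mem _ (hmem _) _ (hmem _) hle c hc)
    have h01 : f {0} ≤ f t ∧ f {1} ≤ f t := ⟨hc.1 (by simp), hc.1 (by simp)⟩
    simp only [hf, Set.singleton_subset_iff] at h01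
    have hsub : ({2}ᶜ : Set (Fin 3)) ⊆ t := by
      intro i hi
      fin_cases i <;> simp_all
    have hge : f t ≤ f {2}ᶜ := hc.2 (by simp [hf])
    rw [hcompl, ← Set.Subset.antisymm ((hf _ _).1 hge) hsub]
    exact hc
  refine ⟨_, _, _, ht, (Set.eq_of_subset_of_ncard_le
    (hC.tripleSpan_subset (hmem _) (hmem _) (hmem _))
    (by rw [h, ht.isBooleanSubalgebra_tripleSpan.2])
    (Set.finite_of_ncard_ne_zero (by simp [h]))).symm⟩

end IsBooleanSubalgebra

/-! ### Coordinatizations -/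

namespace PreOrthogeometry

open OrthomodularPoset

variable {P : Type u} {G : PreOrthogeometry P}

/-- A coordinatization of `G` by an orthomodular poset: the nontrivial elements `a` are assigned to
points `p`, written `On a p`, so that the fibers are the pairs `{a, aᶜ}` and the lines come from
orthogonal triples. -/
structure IsCoordinatization (G : PreOrthogeometry P) {A : Type v} [OrthomodularPoset A]
    (On : A → P → Prop) : Prop where
  exists_on_point : ∀ p, ∃ a, On a p
  exists_point : ∀ a, a ≠ ⊥ → a ≠ ⊤ → ∃ p, On a p
  ne_bot : ∀ {a p}, On a p → a ≠ ⊥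
  ne_top : ∀ {a p}, On a p → a ≠ ⊤
  eq_or_eq_compl : ∀ {a b p}, On a p → On b p → b = a ∨ b = aᶜ
  compl : ∀ {a p}, On a p → On aᶜ p
  point_unique : ∀ {a p q}, On a p → On a q → p = q
  line_mem : ∀ {x y z p q r}, OrthoTriple x y z → On x p → On y q → On z r →
    ({p, q, r} : Set P) ∈ G.lines
  exists_triple : ∀ l ∈ G.lines, ∃ x y z p q r, OrthoTriple x y z ∧ On x p ∧ On y q ∧ On z r ∧
    l = {p, q, r}

/-- `On a p` says that a is a nontrivial element of the subalgebra of p. Later arguments use this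
relation in place of the isomorphism. -/
theorem IsOrthogeometryOf.exists_isCoordinatization {A : Type v} [OrthomodularPoset A]
    (h : G.IsOrthogeometryOf A) : ∃ On : A → P → Prop, G.IsCoordinatization On := by
  obtain ⟨φ, hφ⟩ := h
  let On : A → P → Prop := fun a p => a ∈ (φ p).1 ∧ a ≠ ⊥ ∧ a ≠ ⊤
  have hspan : ∀ {a p}, On a p → (φ p).1 = pairSpan a := fun {a p} h =>
    (φ p).2.1.eq_pairSpan (φ p).2.2 h.1 h.2.1 h.2.2
  have hpoint : ∀ a, a ≠ ⊥ → a ≠ ⊤ → ∃ p, On a p := fun a h₀ h₁ => by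
    obtain ⟨p, hp⟩ := φ.surjective ⟨pairSpan a, isBooleanSubalgebra_pairSpan h₀ h₁⟩
    exact ⟨p, by rw [hp]; simp [mem_pairSpan], h₀, h₁⟩
  have heq : ∀ {a b p}, On a p → On b p → b = a ∨ b = aᶜ := fun {a b p} ha hb => by
    have := hb.1
    rw [hspan ha, mem_pairSpan] at this
    have := hb.2
    tauto
  have hcompl : ∀ {a p}, On a p → On aᶜ p := fun {a p} h =>
    ⟨(φ p).2.1.compl_mem _ h.1, compl_ne_bot h.2.2, compl_ne_top h.2.1⟩
  have huniq : ∀ {a p q}, On a p → On a q → p = q := fun {a p q} hp hq =>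
    φ.injective (Subtype.ext ((hspan hp).trans (hspan hq).symm))
  -- The six nontrivial elements of the span form three complementary pairs, which are its only
  -- points.
  have hline : ∀ {x y z p q r}, OrthoTriple x y z → On x p → On y q → On z r →
      φ '' ({p, q, r} : Set P) = {b | b.1 ⊆ tripleSpan x y z} := by
    intro x y z p q r h hx hy hz
    have hB := h.isBooleanSubalgebra_tripleSpan.1
    ext b
    obtain ⟨s, rfl⟩ := φ.surjective b
    rw [φ.injective.mem_set_image, Set.mem_ofPred_eq]
    constructor
    · rintro (rfl | rfl | rfl)
      · rw [hspan hx]; exact hB.pairSpan_subset (by simp [tripleSpan])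
      · rw [hspan hy]; exact hB.pairSpan_subset (by simp [tripleSpan])
      · rw [hspan hz]; exact hB.pairSpan_subset (by simp [tripleSpan])
    · intro hs
      obtain ⟨a, ha, h₀, h₁⟩ := IsBooleanSubalgebra.exists_mem_ne (φ s).2.2
      have hon : On a s := ⟨ha, h₀, h₁⟩
      rcases hs ha with rfl | rfl | rfl | rfl | rfl | rfl | rfl | rfl
      · exact (h₀ rfl).elim
      · exact (h₁ rfl).elim
      · exact .inl (huniq hon hx)
      · exact .inr (.inl (huniq hon hy))
      · exact .inr (.inr (huniq hon hz))
      · exact .inl (huniq hon (hcompl hx))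
      · exact .inr (.inl (huniq hon (hcompl hy)))
      · exact .inr (.inr (huniq hon (hcompl hz)))
  refine ⟨On, fun p => ?_, hpoint, fun h => h.2.1, fun h => h.2.2, heq, hcompl, huniq, ?_, ?_⟩
  · obtain ⟨a, ha⟩ := IsBooleanSubalgebra.exists_mem_ne (φ p).2.2
    exact ⟨a, ha⟩
  · intro x y z p q r h hx hy hz
    rw [hφ]
    exact ⟨_, h.isBooleanSubalgebra_tripleSpan.1, h.isBooleanSubalgebra_tripleSpan.2,
      hline h hx hy hz⟩
  · intro l hl
    obtain ⟨C, hC, h8, hlC⟩ := (hφ l).1 hl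
    obtain ⟨x, y, z, h, rfl⟩ := hC.exists_eq_tripleSpan h8
    obtain ⟨p, hx⟩ := hpoint x h.left_ne_bot h.left_ne_top
    obtain ⟨q, hy⟩ := hpoint y h.mid_ne_bot h.rotate.left_ne_top
    obtain ⟨r, hz⟩ := hpoint z h.right_ne_bot h.rotate.rotate.left_ne_top
    exact ⟨x, y, z, p, q, r, h, hx, hy, hz,
      φ.injective.image_injective (hlC.trans (hline h hx hy hz).symm)⟩

namespace IsCoordinatization

variable {A : Type v} [OrthomodularPoset A] {On : A → P → Prop} {a b c x y z : A} {p q r : P}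
  {l m : Set P}

theorem point_ne (hO : G.IsCoordinatization On) (h : OrthoTriple x y z) (hx : On x p)
    (hy : On y q) : p ≠ q := by
  rintro rfl
  rcases hO.eq_or_eq_compl hy hx with h' | h'
  exacts [h.left_ne_mid h', h.left_ne_compl_mid h']

theorem exists_points (hO : G.IsCoordinatization On) (h : OrthoTriple x y z) :
    ∃ p q r, On x p ∧ On y q ∧ On z r := by
  obtain ⟨p, hx⟩ := hO.exists_point x h.left_ne_bot h.left_ne_top
  obtain ⟨q, hy⟩ := hO.exists_point y h.mid_ne_bot h.rotate.left_ne_top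
  obtain ⟨r, hz⟩ := hO.exists_point z h.right_ne_bot h.rotate.rotate.left_ne_top
  exact ⟨p, q, r, hx, hy, hz⟩

/-- `a` is an atom of the Boolean algebra that the line `l` comes from. -/
def IsAtomOf (On : A → P → Prop) (a : A) (l : Set P) : Prop :=
  ∃ y z p q r, OrthoTriple a y z ∧ On a p ∧ On y q ∧ On z r ∧ l = {p, q, r}

/-- Up to complement, the two triples would share a further member, coming from the same point. In
the first triple it lies below aᶜ, in the second below a. -/
theorem not_isAtomOf_compl (hO : G.IsCoordinatization On) (h : IsAtomOf On a l) :
    ¬ IsAtomOf On aᶜ l := by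
  obtain ⟨y, z, p, q, r, h, ha, hy, hz, rfl⟩ := h
  rintro ⟨u, v, p', q', r', h', ha', hu, hv, heq⟩
  obtain rfl := hO.point_unique (hO.compl ha) ha'
  have key : ∀ {u v}, OrthoTriple aᶜ u v → On u q → False := by
    intro u v h' hu
    have hua : u ≤ a := by simpa only [OrthomodularPoset.compl_compl] using h'.swap.le_compl
    rcases hO.eq_or_eq_compl hy hu with rfl | rfl
    · exact h.mid_ne_bot (eq_bot_of_le_of_le_compl hua h.swap.le_compl)
    · have : a = yᶜ := le_antisymm h.le_compl hua
      exact h.left_ne_compl_mid this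
  have hq : q ∈ ({p, q', r'} : Set P) := heq ▸ (by simp)
  rcases hq with rfl | rfl | rfl
  · exact hO.point_ne h ha hy rfl
  · exact key h' hu
  · exact key h'.swap_right hv

theorem isAtomOf_or (hO : G.IsCoordinatization On) (hl : l ∈ G.lines) (hp : p ∈ l) (ha : On a p) :
    IsAtomOf On a l ∨ IsAtomOf On aᶜ l := by
  obtain ⟨x, y, z, p', q, r, h, hx, hy, hz, rfl⟩ := hO.exists_triple l hl
  have key : ∀ {x y z p' q r}, OrthoTriple x y z → On x p' → On y q → On z r → p = p' →
      IsAtomOf On a {p', q, r} ∨ IsAtomOf On aᶜ {p', q, r} := by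
    rintro x y z _ q r h hx hy hz rfl
    rcases hO.eq_or_eq_compl ha hx with rfl | rfl
    · exact .inl ⟨y, z, p, q, r, h, hx, hy, hz, rfl⟩
    · exact .inr ⟨y, z, p, q, r, h, hx, hy, hz, rfl⟩
  rcases hp with hp | hp | hp
  · exact key h hx hy hz hp
  · rw [show ({p', q, r} : Set P) = {q, p', r} from Set.insert_comm _ _ _]
    exact key h.swap hy hx hz hp
  · rw [show ({p', q, r} : Set P) = {r, p', q} by ext; simp; tauto]
    exact key h.rotate.rotate hz hx hy hp

theorem isAtomOf_compl_iff (hO : G.IsCoordinatization On) (hl : l ∈ G.lines) (hp : p ∈ l)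
    (ha : On a p) : IsAtomOf On aᶜ l ↔ ¬ IsAtomOf On a l :=
  ⟨fun h h' => hO.not_isAtomOf_compl h' h, (hO.isAtomOf_or hl hp ha).resolve_left⟩

theorem le_compl_of_isAtomOf (hO : G.IsCoordinatization On) (ha : IsAtomOf On a l)
    (hb : IsAtomOf On b l) (hap : On a p) (hbq : On b q) (hpq : p ≠ q) : a ≤ bᶜ := by
  have hb' := hO.not_isAtomOf_compl hb
  obtain ⟨y, z, p', q', r', h, ha', hy, hz, rfl⟩ := ha
  obtain rfl := hO.point_unique hap ha'
  obtain ⟨u, v, q₀, s, t, -, hb₀, -, -, heq⟩ := hb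
  obtain rfl := hO.point_unique hbq hb₀
  have hq : q ∈ ({p, q', r'} : Set P) := heq ▸ (by simp)
  rcases hq with rfl | rfl | rfl
  · exact (hpq rfl).elim
  · rcases hO.eq_or_eq_compl hy hbq with rfl | rfl
    · exact h.le_compl
    · rw [OrthomodularPoset.compl_compl] at hb'
      exact (hb' ⟨a, z, q, p, r', h.swap, hy, hap, hz, Set.insert_comm _ _ _⟩).elim
  · rcases hO.eq_or_eq_compl hz hbq with rfl | rfl
    · exact h.left_le
    · rw [OrthomodularPoset.compl_compl] at hb'
      exact (hb' ⟨a, y, q, p, q', h.rotate.rotate, hz, hap, hy, by ext; simp; tauto⟩).elim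

/-- Elements on a line are atoms or coatoms of its algebra, and distinct atoms are orthogonal. This
translates collinearity into algebra, both to exclude lines and to exploit them. -/
theorem comparable_of_mem (hO : G.IsCoordinatization On) (hl : l ∈ G.lines) (hp : p ∈ l)
    (hq : q ∈ l) (ha : On a p) (hb : On b q) : Comparable a b := by
  by_cases hpq : p = q
  · subst hpq
    rcases hO.eq_or_eq_compl ha hb with rfl | rfl
    · exact .inl le_rfl
    · exact .inr (.inl (OrthomodularPoset.compl_compl a).ge)
  · rcases hO.isAtomOf_or hl hp ha with h | h <;> rcases hO.isAtomOf_or hl hq hb with h' | h'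
    · exact .inr (.inl (hO.le_compl_of_isAtomOf h h' ha hb hpq))
    · have := hO.le_compl_of_isAtomOf h h' ha (hO.compl hb) hpq
      rw [OrthomodularPoset.compl_compl] at this
      exact .inl this
    · exact .inr (.inr (.inr (hO.le_compl_of_isAtomOf h h' (hO.compl ha) hb hpq)))
    · have := hO.le_compl_of_isAtomOf h h' (hO.compl ha) (hO.compl hb) hpq
      rw [OrthomodularPoset.compl_compl] at this
      exact .inr (.inr (.inl this))

end IsCoordinatization

end PreOrthogeometry

/-! ### Planes -/

namespace PreOrthogeometry

open OrthomodularPoset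

variable {P : Type u} {G : PreOrthogeometry P}

/-- The lines of the standard plane as finite sets. -/
def planeFinsets : Finset (Finset (Fin 7)) :=
  {{0, 1, 4}, {0, 2, 5}, {1, 2, 6}, {2, 3, 4}, {1, 3, 5}, {0, 3, 6}}

theorem mem_planeLines_iff {t : Set (Fin 7)} : t ∈ planeLines ↔ ∃ s ∈ planeFinsets, ↑s = t := by
  simp [planeLines, planeFinsets, eq_comm]

set_option maxRecDepth 100000 in
theorem exists_planeFinsets_or : ∀ i j : Fin 7, i ≠ j →
    (∃ t ∈ planeFinsets, i ∈ t ∧ j ∈ t) ∨ (4 ≤ i ∧ 4 ≤ j) := by decide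

set_option maxRecDepth 100000 in
theorem planeFinsets_card : ∀ t ∈ planeFinsets, t.card = 3 := by decide

set_option maxRecDepth 100000 in
theorem exists_mem_planeFinsets : ∀ i : Fin 7, ∃ t ∈ planeFinsets, i ∈ t := by decide

-- Vertices and center lie on three lines, so i is a midpoint. The remaining points of its two lines
-- are the vertices and the center, any two of which are collinear.
set_option maxRecDepth 100000 in
theorem planeFinsets_cross : ∀ i : Fin 7, ∀ t₁ ∈ planeFinsets, ∀ t₂ ∈ planeFinsets,
    planeFinsets.filter (i ∈ ·) ⊆ {t₁, t₂} → i ∈ t₁ → i ∈ t₂ →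
    ∀ j ∈ t₁.erase i, ∀ k ∈ t₂.erase i, j ≠ k ∧ ∃ t ∈ planeFinsets, j ∈ t ∧ k ∈ t := by
  decide

set_option maxRecDepth 100000 in
theorem eq_or_eq_of_four_mem :
    ∀ t ∈ planeFinsets, 4 ∈ t → t = {2, 3, 4} ∨ t = {0, 1, 4} := by decide

/-- Two points of the standard plane lie on one of the six lines unless both are midpoints, a case
settled by `hn`. So uniqueness of lines leaves no other line meeting the image in two points. -/
theorem isPlane_range {f : Fin 7 → P} (hf : ∀ t ∈ planeFinsets, f '' t ∈ G.lines)
    (hn : ∀ i j : Fin 7, 4 ≤ i → 4 ≤ j → i ≠ j → ∀ l ∈ G.lines, f i ∈ l → f j ∉ l) :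
    Function.Injective f ∧ (∀ t : Set (Fin 7), f '' t ∈ G.lines ↔ t ∈ planeLines) ∧
      G.IsPlane (Set.range f) := by
  have hinjOn : ∀ t ∈ planeFinsets, Set.InjOn f t := fun t ht =>
    Set.injOn_of_ncard_image_eq (by
      rw [G.ncard_line _ (hf t ht), Set.ncard_coe_finset, planeFinsets_card t ht])
  have hinj : Function.Injective f := by
    intro i j hij
    by_contra hne
    rcases exists_planeFinsets_or i j hne with ⟨t, ht, hi, hj⟩ | ⟨hi, hj⟩
    · exact hne (hinjOn t ht hi hj hij)
    · obtain ⟨t, ht, hit⟩ := exists_mem_planeFinsets i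
      exact hn i j hi hj hne _ (hf t ht) ⟨i, hit, rfl⟩ (hij ▸ ⟨i, hit, rfl⟩)
  have key : ∀ l ∈ G.lines, ∀ i j, i ≠ j → f i ∈ l → f j ∈ l →
      ∃ t ∈ planeFinsets, l = f '' t := by
    intro l hl i j hij hi hj
    rcases exists_planeFinsets_or i j hij with ⟨t, ht, hi', hj'⟩ | ⟨hi', hj'⟩
    · exact ⟨t, ht, G.line_unique l hl _ (hf t ht) _ _ (hinj.ne hij) hi hj ⟨i, hi', rfl⟩
        ⟨j, hj', rfl⟩⟩
    · exact (hn i j hi' hj' hij l hl hi hj).elim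
  have hiff : ∀ t : Set (Fin 7), f '' t ∈ G.lines ↔ t ∈ planeLines := by
    intro t
    rw [mem_planeLines_iff]
    constructor
    · intro ht
      have h₁ : 1 < (f '' t).ncard := by rw [G.ncard_line _ ht]; norm_num
      rw [Set.ncard_image_of_injective _ hinj, Set.one_lt_ncard_iff] at h₁
      obtain ⟨i, j, hi, hj, hij⟩ := h₁
      obtain ⟨s, hs, h⟩ := key _ ht i j hij ⟨i, hi, rfl⟩ ⟨j, hj, rfl⟩
      exact ⟨s, hs, hinj.image_injective h.symm⟩
    · rintro ⟨s, hs, rfl⟩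
      exact hf s hs
  refine ⟨hinj, hiff, ?_, f, hinj, rfl, hiff⟩
  rintro l hl _ hp _ hq hpq ⟨i, rfl⟩ ⟨j, rfl⟩
  obtain ⟨t, -, rfl⟩ := key l hl i j (fun h => hpq (h ▸ rfl)) hp hq
  exact Set.image_subset_range _ _

theorem exists_image_eq {f : Fin 7 → P} (hf : ∀ t : Set (Fin 7), f '' t ∈ G.lines ↔ t ∈ planeLines)
    {l : Set P} (hl : l ∈ G.lines) (hlf : l ⊆ Set.range f) :
    ∃ t ∈ planeFinsets, f '' t = l := by
  have h := Set.image_preimage_eq_of_subset hlf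
  rw [← h, hf, mem_planeLines_iff] at hl
  obtain ⟨t, ht, htl⟩ := hl
  exact ⟨t, ht, by rw [htl, h]⟩

namespace IsCoordinatization

variable {A : Type v} [OrthomodularPoset A] {On : A → P → Prop} {a b c x y z : A} {p q r : P}
  {l m : Set P}

/-- Here a = x ∨ y and aᶜ = b ∨ c. The seven points are the four atoms x, y, b, c and the three
splittings of them into pairs, given by a, s, t; each of the six lines merges two atoms. Distinct
splittings are incomparable, hence not collinear. -/
theorem exists_isPlane (hO : G.IsCoordinatization On) (hl : IsAtomOf On a l)
    (hm : IsAtomOf On aᶜ m) (hp : On a p) :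
    ∃ S, G.IsPlane S ∧ {n | n ∈ G.lines ∧ p ∈ n ∧ n ⊆ S} = {l, m} := by
  obtain ⟨b, c, p', pb, pc, h, hp', hb, hc, rfl⟩ := hl
  obtain rfl := hO.point_unique hp hp'
  obtain ⟨x, y, p', px, py, h', hp', hx, hy, rfl⟩ := hm
  obtain rfl := hO.point_unique (hO.compl hp) hp'
  obtain ⟨s, hxb, hyc⟩ := h'.exists_cross h
  obtain ⟨t, hxc, hyb⟩ := h'.exists_cross h.swap_right
  obtain ⟨-, -, ps, -, -, hs⟩ := hO.exists_points hxb
  obtain ⟨-, -, pt, -, -, ht⟩ := hO.exists_points hxc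
  have hxa : x ≤ a := by simpa only [OrthomodularPoset.compl_compl] using h'.swap.le_compl
  have hya : y ≤ a := by
    simpa only [OrthomodularPoset.compl_compl] using h'.swap_right.swap.le_compl
  have hba : b ≤ aᶜ := h.swap.le_compl
  have hca : c ≤ aᶜ := h.swap_right.swap.le_compl
  have hys : y ≤ s := by simpa only [OrthomodularPoset.compl_compl] using hyc.left_le
  have hcs : c ≤ s := by simpa only [OrthomodularPoset.compl_compl] using hyc.mid_le
  have hyt : y ≤ t := by simpa only [OrthomodularPoset.compl_compl] using hyb.left_le
  have hbt : b ≤ t := by simpa only [OrthomodularPoset.compl_compl] using hyb.mid_le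
  have hx₀ := h'.mid_ne_bot
  have hy₀ := h'.right_ne_bot
  have hb₀ := h.mid_ne_bot
  have hc₀ := h.right_ne_bot
  have nas : ¬ Comparable a s := not_comparable hx₀ hy₀ hb₀ hc₀ hxa hya hba hca
    hxb.left_le hxb.mid_le hys hcs
  have nat : ¬ Comparable a t := not_comparable hx₀ hy₀ hc₀ hb₀ hxa hya hca hba
    hxc.left_le hxc.mid_le hyt hbt
  have nst : ¬ Comparable s t := fun H => not_comparable hx₀ hb₀ hc₀ hy₀ hxb.left_le hxb.mid_le
    (by rwa [OrthomodularPoset.compl_compl]) (by rwa [OrthomodularPoset.compl_compl])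
    hxc.left_le hxc.mid_le hbt hyt H.compl_left
  -- Vertices x, y, b and center c; the midpoint of a side is the splitting that pairs its two ends.
  let f : Fin 7 → P := ![px, py, pb, pc, p, ps, pt]
  have hf : ∀ t ∈ planeFinsets, f '' t ∈ G.lines := by
    simp only [planeFinsets, Finset.mem_insert, Finset.mem_singleton, forall_eq_or_imp, forall_eq,
      Finset.coe_insert, Finset.coe_singleton, Set.image_insert_eq, Set.image_singleton]
    exact ⟨hO.line_mem h'.rotate hx hy (hO.compl hp), hO.line_mem hxb hx hb hs,
      hO.line_mem hyb hy hb (hO.compl ht), hO.line_mem h.rotate hb hc hp,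
      hO.line_mem hyc hy hc (hO.compl hs), hO.line_mem hxc hx hc ht⟩
  have hn : ∀ i j : Fin 7, 4 ≤ i → 4 ≤ j → i ≠ j → ∀ l ∈ G.lines, f i ∈ l → f j ∉ l := by
    have key : ∀ {u v q r}, On u q → On v r → ¬ Comparable u v → ∀ l ∈ G.lines, q ∈ l → r ∉ l :=
      fun hu hv H l hl hq hr => H (hO.comparable_of_mem hl hq hr hu hv)
    intro i j hi hj hij
    fin_cases i <;> first | exact absurd hi (by decide) | skip
    all_goals fin_cases j <;> first | exact absurd hj (by decide) | exact absurd rfl hij | skip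
    · exact key hp hs nas
    · exact key hp ht nat
    · exact key hs hp fun H => nas H.symm
    · exact key hs ht nst
    · exact key ht hp fun H => nat H.symm
    · exact key ht hs fun H => nst H.symm
  obtain ⟨hinj, hiff, hplane⟩ := isPlane_range hf hn
  have h₁ : ({p, pb, pc} : Set P) = f '' {2, 3, 4} := by
    simp only [Set.image_insert_eq, Set.image_singleton]
    ext; simp [f]; tauto
  have h₂ : ({p, px, py} : Set P) = f '' {0, 1, 4} := by
    simp only [Set.image_insert_eq, Set.image_singleton]
    ext; simp [f]; tauto
  refine ⟨_, hplane, ?_⟩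
  rw [h₁, h₂]
  ext n
  simp only [Set.mem_ofPred_eq, Set.mem_insert_iff, Set.mem_singleton_iff]
  constructor
  · rintro ⟨hn, hpn, hns⟩
    obtain ⟨t, ht, rfl⟩ := exists_image_eq hiff hn hns
    have h4 : (4 : Fin 7) ∈ t := by
      have : f 4 ∈ f '' (t : Set (Fin 7)) := hpn
      rwa [hinj.mem_set_image, Finset.mem_coe] at this
    rcases eq_or_eq_of_four_mem t ht h4 with rfl | rfl
    · left; simp
    · right; simp
  · rintro (rfl | rfl)
    · exact ⟨(hiff _).2 (by simp [planeLines]), ⟨4, by simp, rfl⟩, Set.image_subset_range _ _⟩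
    · exact ⟨(hiff _).2 (by simp [planeLines]), ⟨4, by simp, rfl⟩, Set.image_subset_range _ _⟩

/-- By `planeFinsets_cross`, the other two points of l are joined to those of m, which
`not_pairwise_comparable` forbids for two triples sharing a. -/
theorem not_isAtomOf_of_isPlane (hO : G.IsCoordinatization On) (hl : IsAtomOf On a l)
    (hp : On a p) {S : Set P} (hS : G.IsPlane S)
    (hlm : {n | n ∈ G.lines ∧ p ∈ n ∧ n ⊆ S} = {l, m}) : ¬ IsAtomOf On a m := by
  intro hm
  obtain ⟨-, f, hinj, rfl, hiff⟩ := hS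
  have hl' : l ∈ G.lines ∧ p ∈ l ∧ l ⊆ Set.range f := hlm.ge (.inl rfl)
  have hm' : m ∈ G.lines ∧ p ∈ m ∧ m ⊆ Set.range f := hlm.ge (.inr rfl)
  obtain ⟨t₁, ht₁, rfl⟩ := exists_image_eq hiff hl'.1 hl'.2.2
  obtain ⟨t₂, ht₂, rfl⟩ := exists_image_eq hiff hm'.1 hm'.2.2
  obtain ⟨i, hi₁, rfl⟩ := hl'.2.1
  have hi₂ : i ∈ t₂ := by simpa [hinj.mem_set_image] using hm'.2.1
  have hline : ∀ t ∈ planeFinsets, f '' t ∈ G.lines := fun t ht =>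
    (hiff _).2 (mem_planeLines_iff.2 ⟨t, ht, rfl⟩)
  have hall : planeFinsets.filter (i ∈ ·) ⊆ {t₁, t₂} := by
    intro t ht
    obtain ⟨ht, hit⟩ := Finset.mem_filter.1 ht
    have : f '' t ∈ ({f '' t₁, f '' t₂} : Set (Set P)) :=
      hlm.le ⟨hline t ht, ⟨i, hit, rfl⟩, Set.image_subset_range _ _⟩
    simpa [hinj.image_injective.eq_iff] using this
  have cross : ∀ u ∈ f '' (t₁ : Set (Fin 7)), ∀ v ∈ f '' (t₂ : Set (Fin 7)), u ≠ f i → v ≠ f i →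
      u ≠ v ∧ ∃ n ∈ G.lines, u ∈ n ∧ v ∈ n := by
    rintro _ ⟨j, hj, rfl⟩ _ ⟨k, hk, rfl⟩ hji hki
    obtain ⟨h, t, ht, hjt, hkt⟩ := planeFinsets_cross i t₁ ht₁ t₂ ht₂ hall hi₁ hi₂
      j (Finset.mem_erase.2 ⟨fun h => hji (h ▸ rfl), hj⟩)
      k (Finset.mem_erase.2 ⟨fun h => hki (h ▸ rfl), hk⟩)
    exact ⟨hinj.ne h, _, hline t ht, ⟨j, hjt, rfl⟩, ⟨k, hkt, rfl⟩⟩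
  obtain ⟨b, c, p', pb, pc, h, hp', hb, hc, h₁⟩ := hl
  obtain rfl := hO.point_unique hp hp'
  obtain ⟨e, g, p', pe, pg, h', hp', he, hg, h₂⟩ := hm
  obtain rfl := hO.point_unique hp hp'
  rw [h₁, h₂] at cross
  have key : ∀ {u v q r}, On u q → On v r → q ∈ ({f i, pb, pc} : Set P) →
      r ∈ ({f i, pe, pg} : Set P) → f i ≠ q → f i ≠ r → Comparable u v ∧ u ≠ v := by
    intro u v q r hu hv hq hr hqi hri
    obtain ⟨hqr, n, hn, hqn, hrn⟩ := cross q hq r hr hqi.symm hri.symm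
    refine ⟨hO.comparable_of_mem hn hqn hrn hu hv, ?_⟩
    rintro rfl
    exact hqr (hO.point_unique hu hv)
  have nb := hO.point_ne h hp hb
  have nc := hO.point_ne h.swap_right hp hc
  have ne := hO.point_ne h' hp he
  have ng := hO.point_ne h'.swap_right hp hg
  have hbe := key hb he (by simp) (by simp) nb ne
  have hbg := key hb hg (by simp) (by simp) nb ng
  exact h.not_pairwise_comparable h' hbe.1 (key hc he (by simp) (by simp) nc ne).1 hbg.1
    (key hc hg (by simp) (by simp) nc ng).1 hbe.2 hbg.2

end IsCoordinatization

end PreOrthogeometry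

/-! ### Directions as elements of the poset -/

namespace PreOrthogeometry

open OrthomodularPoset

variable {P : Type u} {G : PreOrthogeometry P}

theorem Arrow.eq_of_ne_of_ne : ∀ {u v w : Arrow}, u ≠ w → v ≠ w → u = v := by
  rintro (_ | _) (_ | _) (_ | _) <;> simp

theorem DirectionAt.ext_val {p : P} {d e : G.DirectionAt p} (h : d.val = e.val) : d = e := by
  cases d; cases e; cases h; rfl

/-- A direction is determined by its value at a single line. -/
theorem DirectionAt.eq_of_val_eq {p : P} {d e : G.DirectionAt p} (l : G.LineThrough p)
    (h : d.val l = e.val l) : d = e := by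
  refine DirectionAt.ext_val (funext fun m => ?_)
  have hiff : d.val m ≠ d.val l ↔ e.val m ≠ e.val l :=
    (d.val_ne_iff m l).trans (e.val_ne_iff m l).symm
  by_cases hm : d.val m = d.val l
  · rw [hm, h, not_ne_iff.1 (hiff.not.1 (not_ne_iff.2 hm))]
  · exact Arrow.eq_of_ne_of_ne hm (h ▸ hiff.1 hm)

namespace IsCoordinatization

variable {A : Type v} [OrthomodularPoset A] {On : A → P → Prop} {a b c x y z : A} {p q r : P}
  {l m : Set P}

theorem isAtomOf_ne_iff (hO : G.IsCoordinatization On) (hp : On a p) (l m : G.LineThrough p) :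
    ¬ (IsAtomOf On a l.1 ↔ IsAtomOf On a m.1) ↔
      ∃ S : Set P, G.IsPlane S ∧ {n | n ∈ G.lines ∧ p ∈ n ∧ n ⊆ S} = {l.1, m.1} := by
  have hl := hO.isAtomOf_compl_iff l.2.1 l.2.2 hp
  have hm := hO.isAtomOf_compl_iff m.2.1 m.2.2 hp
  constructor
  · intro h
    by_cases h' : IsAtomOf On a l.1
    · exact hO.exists_isPlane h' (by tauto) hp
    · rw [Set.pair_comm]
      exact hO.exists_isPlane (by tauto) (by tauto) hp
  · rintro ⟨S, hS, h⟩ H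
    by_cases h' : IsAtomOf On a l.1
    · exact hO.not_isAtomOf_of_isPlane h' hp hS h (H.1 h')
    · exact hO.not_isAtomOf_of_isPlane (hl.2 h') (hO.compl hp) hS h (hm.2 fun h => h' (H.2 h))

open Classical in
/-- The direction given by a nontrivial element of the coordinatizing orthomodular poset. -/
noncomputable def direction (hO : G.IsCoordinatization On) (hp : On a p) : G.DirectionAt p where
  val l := if IsAtomOf On a l.1 then Arrow.down else Arrow.up
  val_ne_iff l m := by
    rw [← hO.isAtomOf_ne_iff hp l m]
    split_ifs <;> simp [*]

theorem direction_val_eq_down (hO : G.IsCoordinatization On) (hp : On a p) (l : G.LineThrough p) :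
    (hO.direction hp).val l = Arrow.down ↔ IsAtomOf On a l.1 := by
  simp only [direction]
  split_ifs <;> simp [*]

theorem direction_val_eq_up (hO : G.IsCoordinatization On) (hp : On a p) (l : G.LineThrough p) :
    (hO.direction hp).val l = Arrow.up ↔ IsAtomOf On aᶜ l.1 := by
  rw [hO.isAtomOf_compl_iff l.2.1 l.2.2 hp]
  simp only [direction]
  split_ifs <;> simp [*]

/-- `a` corresponds to the direction `d`. -/
inductive Represents (hO : G.IsCoordinatization On) : A → G.Direction → Prop
  | bot : Represents hO ⊥ .zero
  | top : Represents hO ⊤ .one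
  | point {a : A} {p : P} (h : On a p) : Represents hO a (.ofPoint p (hO.direction h))

theorem exists_direction (hO : G.IsCoordinatization On) (a : A) : ∃ d, hO.Represents a d := by
  by_cases h₀ : a = ⊥
  · exact ⟨.zero, h₀ ▸ .bot⟩
  by_cases h₁ : a = ⊤
  · exact ⟨.one, h₁ ▸ .top⟩
  obtain ⟨p, hp⟩ := hO.exists_point a h₀ h₁
  exact ⟨_, .point hp⟩

/-- Properness supplies a line on which to read the arrow. One of a, aᶜ has the same arrow there,
and a single value determines a direction. -/
theorem exists_represents (hO : G.IsCoordinatization On) (hG : G.IsProper) (d : G.Direction) :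
    ∃ a, hO.Represents a d := by
  rcases d with _ | _ | ⟨p, d⟩
  · exact ⟨_, .bot⟩
  · exact ⟨_, .top⟩
  · obtain ⟨a, ha⟩ := hO.exists_on_point p
    obtain ⟨l, hl, hp⟩ := hG p
    rcases hd : d.val ⟨l, hl, hp⟩ with _ | _
    · rcases hO.isAtomOf_or hl hp ha with h | h
      · rw [← OrthomodularPoset.compl_compl a] at h
        have := (hO.direction_val_eq_up (hO.compl ha) ⟨l, hl, hp⟩).2 h
        exact ⟨aᶜ, DirectionAt.eq_of_val_eq _ (hd.trans this.symm) ▸ .point (hO.compl ha)⟩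
      · have := (hO.direction_val_eq_up ha ⟨l, hl, hp⟩).2 h
        exact ⟨a, DirectionAt.eq_of_val_eq _ (hd.trans this.symm) ▸ .point ha⟩
    · rcases hO.isAtomOf_or hl hp ha with h | h
      · have := (hO.direction_val_eq_down ha ⟨l, hl, hp⟩).2 h
        exact ⟨a, DirectionAt.eq_of_val_eq _ (hd.trans this.symm) ▸ .point ha⟩
      · have := (hO.direction_val_eq_down (hO.compl ha) ⟨l, hl, hp⟩).2 h
        exact ⟨aᶜ, DirectionAt.eq_of_val_eq _ (hd.trans this.symm) ▸ .point (hO.compl ha)⟩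

/-- Nontriviality keeps ⊥ = ⊤ from representing both `zero` and `one`. -/
theorem Represents.direction_unique {hO : G.IsCoordinatization On} [Nontrivial A]
    {d e : G.Direction} (hd : hO.Represents a d) (he : hO.Represents a e) : d = e := by
  cases hd with
  | bot => generalize hb : (⊥ : A) = b at he; cases he with
    | bot => rfl
    | top => exact (bot_ne_top hb).elim
    | point h => exact (hO.ne_bot h hb.symm).elim
  | top => generalize hb : (⊤ : A) = b at he; cases he with
    | bot => exact (bot_ne_top hb.symm).elim
    | top => rfl
    | point h => exact (hO.ne_top h hb.symm).elim
  | point h => cases he with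
    | bot => exact (hO.ne_bot h rfl).elim
    | top => exact (hO.ne_top h rfl).elim
    | point h' =>
      obtain rfl := hO.point_unique h h'
      rfl

theorem represents_zero_iff {hO : G.IsCoordinatization On} :
    hO.Represents a .zero ↔ a = ⊥ :=
  ⟨fun h => by cases h; rfl, fun h => h ▸ .bot⟩

theorem represents_one_iff {hO : G.IsCoordinatization On} :
    hO.Represents a .one ↔ a = ⊤ :=
  ⟨fun h => by cases h; rfl, fun h => h ▸ .top⟩

theorem represents_ofPoint {hO : G.IsCoordinatization On} {d : G.DirectionAt p}
    (h : hO.Represents a (.ofPoint p d)) : ∃ hp : On a p, d = hO.direction hp := by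
  cases h with
  | point h => exact ⟨h, rfl⟩

/-- On any line through p, which exists by properness, a and aᶜ have opposite arrows. -/
theorem Represents.unique {hO : G.IsCoordinatization On} (hG : G.IsProper) {d : G.Direction}
    (ha : hO.Represents a d) (hb : hO.Represents b d) : a = b := by
  rcases d with _ | _ | ⟨p, d⟩
  · rw [represents_zero_iff.1 ha, represents_zero_iff.1 hb]
  · rw [represents_one_iff.1 ha, represents_one_iff.1 hb]
  · obtain ⟨hap, rfl⟩ := represents_ofPoint ha
    obtain ⟨hbp, h⟩ := represents_ofPoint hb
    rcases hO.eq_or_eq_compl hbp hap with rfl | rfl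
    · rfl
    · obtain ⟨l, hl, hp⟩ := hG p
      have h₁ := hO.direction_val_eq_down hap ⟨l, hl, hp⟩
      rw [h, hO.direction_val_eq_down hbp ⟨l, hl, hp⟩] at h₁
      have h₂ := hO.isAtomOf_compl_iff hl hp hbp
      tauto

/-! ### Order and minimal cones -/

theorem le_of_represents {hO : G.IsCoordinatization On} (hG : G.IsProper) {d e : G.Direction}
    (ha : hO.Represents a d) (hb : hO.Represents b e) (h : Direction.Le d e) : a ≤ b := by
  obtain ⟨f, h⟩ := h
  cases h with
  | zero_left => rw [represents_zero_iff.1 ha]; exact bot_le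
  | zero_right => exact (ha.unique hG hb).le
  | compl_right => rw [represents_one_iff.1 hb]; exact le_top
  | line l hl p q r hp hq hr hpq hpr hqr d e f hd he hf =>
    obtain ⟨hap, rfl⟩ := represents_ofPoint ha
    obtain ⟨hbr, rfl⟩ := represents_ofPoint hb
    have := hO.le_compl_of_isAtomOf ((hO.direction_val_eq_down hap _).1 hd)
      ((hO.direction_val_eq_up hbr _).1 hf) hap (hO.compl hbr) hpr
    rwa [OrthomodularPoset.compl_compl] at this

/-- For nontrivial a < b, complete a and bᶜ to a triple with third member z. Then b = a ∨ z, and the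
direction of z is the required summand. -/
theorem Represents.le {hO : G.IsCoordinatization On} [Nontrivial A] {d e : G.Direction}
    (ha : hO.Represents a d) (hb : hO.Represents b e) (h : a ≤ b) : Direction.Le d e := by
  by_cases hab : a = b
  · subst hab
    rw [ha.direction_unique hb]
    exact ⟨.zero, .zero_right _⟩
  cases ha with
  | bot => exact ⟨e, .zero_left e⟩
  | top => exact (hab (top_le_iff.1 h).symm).elim
  | @point a p hp =>
    cases hb with
    | bot => exact (hab (le_bot_iff.1 h)).elim
    | top => exact ⟨_, .compl_right _⟩
    | @point b r hr =>
      have hbb := OrthomodularPoset.compl_compl b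
      obtain ⟨z, hz⟩ := exists_orthoTriple (hO.ne_bot hp) (hO.ne_bot (hO.compl hr))
        (by rwa [hbb]) (by rwa [hbb])
      obtain ⟨-, q, -, -, hq, -⟩ := hO.exists_points hz.swap_right
      have hl := hO.line_mem hz hp (hO.compl hr) hq
      refine ⟨_, .line _ hl p q r (by simp) (by simp) (by simp) (hO.point_ne hz.swap_right hp hq)
        (hO.point_ne hz hp (hO.compl hr)) (hO.point_ne hz.rotate (hO.compl hr) hq).symm
        _ (hO.direction hq) _ ?_ ?_ ?_⟩
      · exact (hO.direction_val_eq_down hp _).2 ⟨_, _, _, _, _, hz, hp, hO.compl hr, hq, rfl⟩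
      · exact (hO.direction_val_eq_down hq _).2
          ⟨_, _, _, _, _, hz.rotate.rotate, hq, hp, hO.compl hr, by ext; simp; tauto⟩
      · exact (hO.direction_val_eq_up hr _).2
          ⟨_, _, _, _, _, hz.swap, hO.compl hr, hp, hq, Set.insert_comm _ _ _⟩

theorem Represents.le_iff {hO : G.IsCoordinatization On} [Nontrivial A] (hG : G.IsProper)
    {d e : G.Direction} (ha : hO.Represents a d) (hb : hO.Represents b e) :
    Direction.Le d e ↔ a ≤ b :=
  ⟨le_of_represents hG ha hb, ha.le hb⟩

/-- Minimal cones of directions are least upper bounds of the corresponding elements. -/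
theorem Represents.isMinimalCone_iff {hO : G.IsCoordinatization On} [Nontrivial A]
    (hG : G.IsProper) {D : Set G.Direction} {e : G.Direction} (hc : hO.Represents c e) :
    IsMinimalCone D e ↔ IsLUB {a | ∃ d ∈ D, hO.Represents a d} c := by
  have key : ∀ {b f}, hO.Represents b f →
      (IsCone D f ↔ b ∈ upperBounds {a | ∃ d ∈ D, hO.Represents a d}) := by
    intro b f hb
    constructor
    · rintro h a ⟨d, hd, ha⟩
      exact (ha.le_iff hG hb).1 (h d hd)
    · intro h d hd
      obtain ⟨a, ha⟩ := hO.exists_represents hG d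
      exact (ha.le_iff hG hb).2 (h ⟨d, hd, ha⟩)
  refine and_congr (key hc) ⟨fun h b hb => ?_, fun h f hf => ?_⟩
  · obtain ⟨f, hf⟩ := hO.exists_direction b
    exact (hc.le_iff hG hf).1 (h f ((key hf).2 hb))
  · obtain ⟨b, hb⟩ := hO.exists_represents hG f
    exact (hc.le_iff hG hb).2 (h ((key hb).1 hf))

theorem exists_isMinimalCone_iff (hO : G.IsCoordinatization On) [Nontrivial A] (hG : G.IsProper)
    {D : Set G.Direction} :
    (∃ e, IsMinimalCone D e) ↔ ∃ c, IsLUB {a | ∃ d ∈ D, hO.Represents a d} c := by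
  constructor
  · rintro ⟨e, he⟩
    obtain ⟨c, hc⟩ := hO.exists_represents hG e
    exact ⟨c, (hc.isMinimalCone_iff hG).1 he⟩
  · rintro ⟨c, hc⟩
    obtain ⟨e, he⟩ := hO.exists_direction c
    exact ⟨e, (he.isMinimalCone_iff hG).2 hc⟩

theorem setOf_represents_pair {hO : G.IsCoordinatization On} (hG : G.IsProper)
    {d e : G.Direction} (ha : hO.Represents a d) (hb : hO.Represents b e) :
    {c | ∃ f ∈ ({d, e} : Set G.Direction), hO.Represents c f} = {a, b} := by
  ext c
  simp only [Set.mem_insert_iff, Set.mem_singleton_iff, exists_eq_or_imp, exists_eq_left,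
    Set.mem_ofPred_eq]
  exact or_congr ⟨fun h => h.unique hG ha, fun h => h ▸ ha⟩
    ⟨fun h => h.unique hG hb, fun h => h ▸ hb⟩

theorem setOf_represents_preimage (hO : G.IsCoordinatization On) (hG : G.IsProper) (S : Set A) :
    {c | ∃ f ∈ {d | ∃ a ∈ S, hO.Represents a d}, hO.Represents c f} = S := by
  ext c
  constructor
  · rintro ⟨f, ⟨a, ha, haf⟩, hcf⟩
    exact hcf.unique hG haf ▸ ha
  · intro hc
    obtain ⟨d, hd⟩ := hO.exists_direction c
    exact ⟨d, ⟨c, hc, hd⟩, hd⟩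

theorem isEmpty_of_subsingleton (hO : G.IsCoordinatization On) [Subsingleton A] : IsEmpty P :=
  ⟨fun p => by
    obtain ⟨a, ha⟩ := hO.exists_on_point p
    exact hO.ne_bot ha (Subsingleton.elim _ _)⟩

end IsCoordinatization

/-- Without points the directions form the chain 0 < 1. This covers the one-element poset, whose
elements do not correspond to directions. -/
theorem exists_isMinimalCone_of_isEmpty [IsEmpty P] (D : Set G.Direction) :
    ∃ e, IsMinimalCone D e := by
  have hle : ∀ d : G.Direction, Direction.Le d .one
    | .zero => ⟨_, .zero_left _⟩
    | .one => ⟨_, .zero_right _⟩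
    | .ofPoint p _ => (IsEmpty.false p).elim
  by_cases h : Direction.one ∈ D
  · exact ⟨.one, fun d _ => hle d, fun f hf => hf _ h⟩
  · refine ⟨.zero, fun d hd => ?_, fun f _ => ⟨f, .zero_left f⟩⟩
    rcases d with _ | _ | ⟨p, _⟩
    exacts [⟨_, .zero_left _⟩, (h hd).elim, (IsEmpty.false p).elim]

end PreOrthogeometry

/-- An orthomodular poset in which any two elements have a least upper bound is an orthomodular
lattice. -/
noncomputable abbrev OrthomodularPoset.toOrthomodularLattice {A : Type u}
    [inst : OrthomodularPoset A]
    (h : ∀ a b : A, ∃ c, IsLUB {a, b} c) : OrthomodularLattice A :=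
  { inst with
    sup := fun a b => (h a b).choose
    inf := fun a b => ((h aᶜ bᶜ).choose)ᶜ
    le_sup_left := fun a b => (h a b).choose_spec.1 (by simp)
    le_sup_right := fun a b => (h a b).choose_spec.1 (by simp)
    sup_le := fun a b c ha hb => (h a b).choose_spec.2 (by simp [ha, hb])
    inf_le_left := fun a b => compl_le_symm ((h aᶜ bᶜ).choose_spec.1 (by simp))
    inf_le_right := fun a b => compl_le_symm ((h aᶜ bᶜ).choose_spec.1 (by simp))
    le_inf := fun a b c hb hc => le_compl_symm ((h bᶜ cᶜ).choose_spec.2 (by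
      simp [OrthomodularPoset.compl_le_compl _ _ hb, OrthomodularPoset.compl_le_compl _ _ hc])) }

/-- An orthomodular poset in which all subsets have a least upper bound is a complete orthomodular
lattice. -/
noncomputable abbrev OrthomodularPoset.toCompleteOrthomodularLattice {A : Type u}
    [inst : OrthomodularPoset A] (h : ∀ S : Set A, ∃ c, IsLUB S c) :
    CompleteOrthomodularLattice A :=
  { toOrthomodularLattice fun a b => h {a, b} with
    sSup := fun S => (h S).choose
    sInf := fun S => (h (lowerBounds S)).choose
    isLUB_sSup := fun S => (h S).choose_spec
    isGLB_sInf := fun S => (isLUB_lowerBounds).1 (h (lowerBounds S)).choose_spec }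

/-! ### The theorem -/

open PreOrthogeometry OrthomodularPoset

theorem mainTheorem5 {P : Type u} (G : PreOrthogeometry P) (hG : G.IsOrthogeometry)
    (hproper : G.IsProper) :
    ((∃ (A : Type u) (_ : OrthomodularLattice A), G.IsOrthogeometryOf A) ↔
      ∀ D : Set G.Direction, D.ncard = 2 →
        ∃ e : G.Direction, PreOrthogeometry.IsMinimalCone D e) ∧
    ((∃ (A : Type u) (_ : CompleteOrthomodularLattice A), G.IsOrthogeometryOf A) ↔
      ∀ D : Set G.Direction, D.Nontrivial →
        ∃ e : G.Direction, PreOrthogeometry.IsMinimalCone D e) := by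
  refine ⟨⟨?_, fun h => ?_⟩, ⟨?_, fun h => ?_⟩⟩
  · rintro ⟨A, _, hA⟩ D hD
    obtain ⟨On, hO⟩ := hA.exists_isCoordinatization
    rcases subsingleton_or_nontrivial A with hs | hs
    · have := hO.isEmpty_of_subsingleton
      exact exists_isMinimalCone_of_isEmpty D
    · obtain ⟨d, e, -, rfl⟩ := Set.ncard_eq_two.1 hD
      obtain ⟨a, ha⟩ := hO.exists_represents hproper d
      obtain ⟨b, hb⟩ := hO.exists_represents hproper e
      rw [hO.exists_isMinimalCone_iff hproper,
        IsCoordinatization.setOf_represents_pair hproper ha hb]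
      exact ⟨a ⊔ b, isLUB_pair⟩
  · obtain ⟨A, inst, hA⟩ := hG
    obtain ⟨On, hO⟩ := hA.exists_isCoordinatization
    have hlub : ∀ a b : A, ∃ c, IsLUB {a, b} c := by
      intro a b
      by_cases hab : a = b
      · exact ⟨a, by simp [hab]⟩
      have : Nontrivial A := ⟨a, b, hab⟩
      obtain ⟨d, ha⟩ := hO.exists_direction a
      obtain ⟨e, hb⟩ := hO.exists_direction b
      rw [← IsCoordinatization.setOf_represents_pair hproper ha hb,
        ← hO.exists_isMinimalCone_iff hproper]
      exact h {d, e} (Set.ncard_pair fun hde => hab (ha.unique hproper (hde ▸ hb)))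
    -- The lattice keeps the order and complement of A, hence also its orthogeometry.
    exact ⟨A, toOrthomodularLattice hlub, hA⟩
  · rintro ⟨A, _, hA⟩ D -
    obtain ⟨On, hO⟩ := hA.exists_isCoordinatization
    rcases subsingleton_or_nontrivial A with hs | hs
    · have := hO.isEmpty_of_subsingleton
      exact exists_isMinimalCone_of_isEmpty D
    · exact (hO.exists_isMinimalCone_iff hproper).2 ⟨_, isLUB_sSup _⟩
  · obtain ⟨A, inst, hA⟩ := hG
    obtain ⟨On, hO⟩ := hA.exists_isCoordinatization
    have hlub : ∀ S : Set A, ∃ c, IsLUB S c := by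
      intro S
      rcases S.subsingleton_or_nontrivial with hS | hS
      · rcases hS.eq_empty_or_singleton with rfl | ⟨a, rfl⟩
        exacts [⟨⊥, isLUB_empty⟩, ⟨a, isLUB_singleton⟩]
      obtain ⟨a, ha, b, hb, hab⟩ := hS
      have : Nontrivial A := ⟨a, b, hab⟩
      rw [← hO.setOf_represents_preimage hproper S, ← hO.exists_isMinimalCone_iff hproper]
      obtain ⟨d, hd⟩ := hO.exists_direction a
      obtain ⟨e, he⟩ := hO.exists_direction b
      exact h _ ⟨d, ⟨a, ha, hd⟩, e, ⟨b, hb, he⟩, fun hde => hab (hd.unique hproper (hde ▸ he))⟩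
    exact ⟨A, toCompleteOrthomodularLattice hlub, hA⟩
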